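/- **Notation.** Let $\mathbb{C}_+=\{z:\operatorname{Im} z>0\}$ and $\mathbb{D}=\{z:|z|<1\}$. Let $\mathscr{H}^2$ be the Hardy space of holomorphic $f$ on $\mathbb{C}_+$ with $\sup_{y>0}\int_{\mathbb{R}}|f(x+iy)|^2\,dx<\infty$, with the inner product $\langle f,g\rangle=\int_{\mathbb{R}} f(x)\overline{g(x)}\,dx$ of boundary functions. An inner function on $\mathbb{C}_+$ is a holomorphic $U$ with $|U|\le 1$ on $\mathbb{C}_+$ and boundary values of modulus $1$ almost everywhere on $\mathbb{R}$. For an inner function $U$ let $\mathscr{K}_U=\mathscr{H}^2\cap(U\mathscr{H}^2)^{\perp}$, and for inner functions $U,V$ let $$\mathscr{M}(U,V)=\{\Phi\ \text{holomorphic on}\ \mathbb{C}_+ : \Phi\,\mathscr{K}_U\subseteq\mathscr{K}_V\}.$$ Let $\sigma(U)=\{\xi\in\mathbb{R}\cup\{\infty\}:\liminf_{z\to\xi,\ z\in\mathbb{C}_+}|U(z)|=0\}$ be the boundary spectrum of $U$. With $u=U\circ\omega^{-1}$, $\omega(z)=\frac{z-i}{z+i}$, say that $U$ has a finite angular derivative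 at $\infty$ if $$\liminf_{z\to 1,\ z\in\mathbb{D}}\frac{1-|u(z)|}{1-|z|}<\infty .$$ **Proposition.** There exist inner functions $U$ and $V$ on the upper half plane such that $\mathscr{M}(U,V)\neq\{0\}$, $\sigma(U)=\sigma(V)=\{\infty\}$, and $V$ has a finite angular derivative at $\infty$ while $U$ does not. -/

import Mathlib

open Filter Topology MeasureTheory
open scoped ENNReal NNReal

noncomputable section

namespace HalfPlaneModel

/-! The upper half plane is the set `upperHalfPlaneSet` of Mathlib. Functions on it are represented by
functions `ℂ → ℂ` of which only the values on this set are ever used. -/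

open Classical in
/-- The boundary function of `f` on the real line: the vertical limit
`lim_{y → 0+} f (x + i y)` where it exists, and `0` elsewhere. For a function in the Hardy space
the limit exists for almost every `x` (Fatou) and the boundary function is in `L²(ℝ)`. -/
def boundaryValue (f : ℂ → ℂ) (x : ℝ) : ℂ :=
  if h : ∃ w : ℂ, Tendsto (fun y : ℝ => f (x + y * Complex.I)) (𝓝[>] 0) (𝓝 w) then h.choose else 0

/-- The Hardy space `H²` of the upper half plane: holomorphic functions with
`sup_{y > 0} ∫ |f (x + i y)|² dx < ∞`. -/
def HardyTwo : Set (ℂ → ℂ) :=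
  {f | DifferentiableOn ℂ f UpperHalfPlane.upperHalfPlaneSet ∧
    ∃ C : ℝ≥0, ∀ y : ℝ, 0 < y → ∫⁻ x : ℝ, ‖f (x + y * Complex.I)‖ₑ ^ 2 ≤ C}

/-- The inner product of `H²`, that of the boundary functions in `L²(ℝ)`. -/
def hardyInner (f g : ℂ → ℂ) : ℂ :=
  ∫ x : ℝ, boundaryValue f x * starRingEnd ℂ (boundaryValue g x)

/-- Inner functions on the upper half plane: holomorphic, bounded by `1` in modulus, with
boundary limits of modulus `1` almost everywhere. -/
structure IsInner (U : ℂ → ℂ) : Prop where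
  differentiableOn : DifferentiableOn ℂ U UpperHalfPlane.upperHalfPlaneSet
  norm_le_one : ∀ z ∈ UpperHalfPlane.upperHalfPlaneSet, ‖U z‖ ≤ 1
  boundary : ∀ᵐ x : ℝ, ∃ w : ℂ, ‖w‖ = 1 ∧
    Tendsto (fun y : ℝ => U (x + y * Complex.I)) (𝓝[>] 0) (𝓝 w)

/-- The model space `K_U = H² ∩ (U H²)^⊥`. -/
def modelSpace (U : ℂ → ℂ) : Set (ℂ → ℂ) :=
  {f | f ∈ HardyTwo ∧ ∀ h ∈ HardyTwo, hardyInner f (fun z => U z * h z) = 0}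

/-- The multipliers from `K_U` into `K_V`: holomorphic `Φ` on the upper half plane with
`Φ K_U ⊆ K_V`. -/
def multipliers (U V : ℂ → ℂ) : Set (ℂ → ℂ) :=
  {Φ | DifferentiableOn ℂ Φ UpperHalfPlane.upperHalfPlaneSet ∧
    ∀ f ∈ modelSpace U, (fun z => Φ z * f z) ∈ modelSpace V}

/-- The filter of `z → ξ`, `z` in the upper half plane, for a point `ξ` of the extended real line
`ℝ ∪ {∞}`, regarded as a subset of the Riemann sphere. -/
def approach (ξ : OnePoint ℝ) : Filter ℂ :=
  comap (fun z : ℂ => (z : OnePoint ℂ)) (𝓝 (OnePoint.map Complex.ofReal ξ)) ⊓ 𝓟 UpperHalfPlane.upperHalfPlaneSet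

/-- The boundary spectrum `σ(U)`: the points `ξ ∈ ℝ ∪ {∞}` with `liminf_{z → ξ} |U z| = 0`. -/
def boundarySpectrum (U : ℂ → ℂ) : Set (OnePoint ℝ) :=
  {ξ | liminf (fun z => ‖U z‖ₑ) (approach ξ) = 0}

/-- A function `u` on the unit disk has a finite angular derivative at the point `ζ` of the unit
circle: `liminf_{z → ζ} (1 - |u z|) / (1 - |z|) < ∞`, where `z` is in the open disk. -/
def HasFiniteAngularDeriv (u : ℂ → ℂ) (ζ : ℂ) : Prop :=
  liminf (fun z : ℂ => (((1 - ‖u z‖) / (1 - ‖z‖) : ℝ) : EReal))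
    (𝓝[Metric.ball (0 : ℂ) 1] ζ) < ⊤

/-- The inverse `z ↦ i (1 + z) / (1 - z)` of the Cayley map `w ↦ (w - i) / (w + i)`; it maps the
open unit disk onto the upper half plane and corresponds `1` to `∞`. -/
def cayleyInv (z : ℂ) : ℂ := Complex.I * (1 + z) / (1 - z)

/-- `U` has a finite angular derivative at `∞`: its transplant to the disk has one at `1`. -/
def HasFiniteAngularDerivAtInfty (U : ℂ → ℂ) : Prop :=
  HasFiniteAngularDeriv (fun z => U (cayleyInv z)) 1

end HalfPlaneModel

end

open Filter Topology MeasureTheory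
open scoped ENNReal NNReal

noncomputable section

namespace HalfPlaneModel

open Complex
open UpperHalfPlane (upperHalfPlaneSet)

/-! ### Boundary values and Hardy functions -/

/-! Take `U = exp (2 i z)` and `V = (z - i) / (z + i) * (w - i) / (w + i)` with `w = z + tan z`,
which has positive imaginary part on the upper half plane. Clearing the poles of `tan` gives `(w -
i) / (w + i) = N / D` with `N`, `D` entire, and `N = U D̄` on the real line. Hence `Φ = 1 / ((z + i)
D)` satisfies `V Φ̄ = U Φ` there. As `Φ` is bounded, `⟨Φ f, V k⟩ = ⟨f, U Φ k⟩ = 0` for `f ∈ K_U`, so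
`Φ` is a multiplier (`mem_multipliers_of_conj_mul_eq`, `tanInner_mul_conj_tanMultiplier`).

Both functions are continuous and unimodular on the real line, so only `∞` can lie in either
spectrum. It does: `U` tends to `0` along the imaginary axis, and `w` comes close to `i` near each
large pole of `tan`. Along the imaginary axis, however, `w` grows like `z`, so `1 - |V| = O(1/y)`,
which is a finite angular derivative; for `U` the quotient tends to infinity. -/

lemma boundaryValue_eq_of_tendsto {f : ℂ → ℂ} {x : ℝ} {w : ℂ}
    (h : Tendsto (fun y : ℝ => f (x + y * I)) (𝓝[>] 0) (𝓝 w)) : boundaryValue f x = w := by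
  have hex : ∃ w : ℂ, Tendsto (fun y : ℝ => f (x + y * I)) (𝓝[>] 0) (𝓝 w) := ⟨w, h⟩
  rw [boundaryValue, dif_pos hex]
  exact tendsto_nhds_unique hex.choose_spec h

/-- Since `w ≠ 0`, the product has a vertical limit exactly when `f` does; otherwise both sides take
the default value `0`. The identity thus holds at every point, without Fatou's theorem. -/
lemma boundaryValue_mul {g f : ℂ → ℂ} {x : ℝ} {w : ℂ} (hw : w ≠ 0)
    (h : Tendsto (fun y : ℝ => g (x + y * I)) (𝓝[>] 0) (𝓝 w)) :
    boundaryValue (fun z => g z * f z) x = w * boundaryValue f x := by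
  by_cases hex : ∃ v : ℂ, Tendsto (fun y : ℝ => f (x + y * I)) (𝓝[>] 0) (𝓝 v)
  · obtain ⟨v, hv⟩ := hex
    rw [boundaryValue_eq_of_tendsto hv, boundaryValue_eq_of_tendsto (h.mul hv)]
  · have hex' : ¬ ∃ v : ℂ, Tendsto (fun y : ℝ => (fun z => g z * f z) (x + y * I))
        (𝓝[>] 0) (𝓝 v) := by
      rintro ⟨v, hv⟩
      refine hex ⟨w⁻¹ * v, ((h.inv₀ hw).mul hv).congr' ?_⟩
      filter_upwards [h.eventually_ne hw] with y hy
      exact inv_mul_cancel_left₀ hy _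
    rw [boundaryValue, dif_neg hex', boundaryValue, dif_neg hex, mul_zero]

lemma tendsto_vertical (x : ℝ) :
    Tendsto (fun y : ℝ => (x + y * I : ℂ)) (𝓝[>] 0) (𝓝 (x : ℂ)) := by
  have h : Continuous (fun y : ℝ => (x + y * I : ℂ)) := by fun_prop
  simpa using (h.tendsto 0).mono_left nhdsWithin_le_nhds

lemma ContinuousAt.tendsto_boundary {f : ℂ → ℂ} {x : ℝ} (h : ContinuousAt f x) :
    Tendsto (fun y : ℝ => f (x + y * I)) (𝓝[>] 0) (𝓝 (f x)) :=
  h.tendsto.comp (tendsto_vertical x)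

lemma HardyTwo.mul_of_norm_le_one {g f : ℂ → ℂ} (hg : DifferentiableOn ℂ g upperHalfPlaneSet)
    (hg1 : ∀ z ∈ upperHalfPlaneSet, ‖g z‖ ≤ 1) (hf : f ∈ HardyTwo) :
    (fun z => g z * f z) ∈ HardyTwo := by
  obtain ⟨hd, C, hC⟩ := hf
  refine ⟨hg.mul hd, C, fun y hy => (lintegral_mono fun x => ?_).trans (hC y hy)⟩
  have h1 : ‖g (x + y * I)‖ₑ ≤ 1 := by
    have := hg1 (x + y * I) (by simpa [upperHalfPlaneSet] using hy)
    rwa [← ofReal_norm, ENNReal.ofReal_le_one]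
  calc ‖g (x + y * I) * f (x + y * I)‖ₑ ^ 2
      = (‖g (x + y * I)‖ₑ * ‖f (x + y * I)‖ₑ) ^ 2 := by rw [enorm_mul]
    _ ≤ (1 * ‖f (x + y * I)‖ₑ) ^ 2 := by gcongr
    _ = ‖f (x + y * I)‖ₑ ^ 2 := by rw [one_mul]

/-- A function `Φ` in the unit ball of `H^∞` that is continuous and non-zero on the real line and
satisfies `V Φ̄ = U Φ` there is a multiplier from `K_U` into `K_V`. -/
lemma mem_multipliers_of_conj_mul_eq {U V Φ : ℂ → ℂ}
    (hΦ : DifferentiableOn ℂ Φ upperHalfPlaneSet) (hΦ1 : ∀ z ∈ upperHalfPlaneSet, ‖Φ z‖ ≤ 1)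
    (hΦc : ∀ x : ℝ, ContinuousAt Φ x) (hΦ0 : ∀ x : ℝ, Φ x ≠ 0)
    (hUc : ∀ x : ℝ, ContinuousAt U x) (hU0 : ∀ x : ℝ, U x ≠ 0)
    (hVc : ∀ x : ℝ, ContinuousAt V x) (hV0 : ∀ x : ℝ, V x ≠ 0)
    (h : ∀ x : ℝ, V x * starRingEnd ℂ (Φ x) = U x * Φ x) :
    Φ ∈ multipliers U V := by
  refine ⟨hΦ, fun f hf => ⟨HardyTwo.mul_of_norm_le_one hΦ hΦ1 hf.1, fun k hk => ?_⟩⟩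
  rw [← hf.2 _ (HardyTwo.mul_of_norm_le_one hΦ hΦ1 hk), hardyInner, hardyInner]
  -- The integrands of `⟨Φ f, V k⟩` and `⟨f, U Φ k⟩` agree pointwise, by the conjugate of `h`.
  congr 1
  ext x
  rw [boundaryValue_mul (hΦ0 x) (ContinuousAt.tendsto_boundary (hΦc x)),
    boundaryValue_mul (hV0 x) (ContinuousAt.tendsto_boundary (hVc x)),
    boundaryValue_mul (hU0 x) (ContinuousAt.tendsto_boundary (hUc x)),
    boundaryValue_mul (hΦ0 x) (ContinuousAt.tendsto_boundary (hΦc x))]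
  have h' := congrArg (starRingEnd ℂ) (h x)
  simp only [map_mul, conj_conj] at h' ⊢
  linear_combination boundaryValue f x * starRingEnd ℂ (boundaryValue k x) * h'

/-! ### Boundary spectrum -/

lemma approach_coe (ξ : ℝ) : approach (ξ : OnePoint ℝ) = 𝓝[upperHalfPlaneSet] (ξ : ℂ) := by
  rw [approach, OnePoint.map_some, OnePoint.comap_coe_nhds, nhdsWithin]

lemma approach_infty : approach OnePoint.infty = cocompact ℂ ⊓ 𝓟 upperHalfPlaneSet := by
  rw [approach, OnePoint.map_infty, OnePoint.comap_coe_nhds_infty, coclosedCompact_eq_cocompact]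

lemma coe_notMem_boundarySpectrum {U : ℂ → ℂ} {ξ : ℝ} (hc : ContinuousAt U ξ) (h1 : ‖U ξ‖ = 1) :
    (ξ : OnePoint ℝ) ∉ boundarySpectrum U := by
  intro h
  have h : liminf (fun z => ‖U z‖ₑ) (approach ξ) = 0 := h
  rw [approach_coe] at h
  have ht : Tendsto (fun z => ‖U z‖ₑ) (𝓝[upperHalfPlaneSet] (ξ : ℂ)) (𝓝 ‖U ξ‖ₑ) :=
    (hc.enorm.tendsto).mono_left nhdsWithin_le_nhds
  have h2 : ‖U ξ‖ₑ = 1 := by rw [← ofReal_norm, h1, ENNReal.ofReal_one]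
  rw [h2] at ht
  have h3 : (2⁻¹ : ℝ≥0∞) ≤ liminf (fun z => ‖U z‖ₑ) (𝓝[upperHalfPlaneSet] (ξ : ℂ)) :=
    le_liminf_of_le (by isBoundedDefault)
      ((ht.eventually (lt_mem_nhds ENNReal.one_half_lt_one)).mono fun _ hz => hz.le)
  rw [h] at h3
  simp at h3

lemma infty_mem_boundarySpectrum {U : ℂ → ℂ} {z : ℕ → ℂ}
    (hz : Tendsto z atTop (cocompact ℂ)) (hz' : ∀ᶠ n in atTop, z n ∈ upperHalfPlaneSet)
    (h0 : Tendsto (fun n => U (z n)) atTop (𝓝 0)) :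
    OnePoint.infty ∈ boundarySpectrum U := by
  change liminf (fun z => ‖U z‖ₑ) (approach OnePoint.infty) = 0
  have hz2 : Tendsto z atTop (approach OnePoint.infty) := by
    rw [approach_infty]
    exact tendsto_inf.2 ⟨hz, tendsto_principal.2 hz'⟩
  have h0' : Tendsto (fun n => ‖U (z n)‖ₑ) atTop (𝓝 0) := by simpa using h0.enorm
  refine le_antisymm ?_ bot_le
  calc liminf (fun z => ‖U z‖ₑ) (approach OnePoint.infty)
      ≤ liminf (fun z => ‖U z‖ₑ) (map z atTop) := liminf_le_liminf_of_le hz2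
    _ = 0 := h0'.liminf_eq

lemma boundarySpectrum_eq_singleton_infty {U : ℂ → ℂ} (hc : ∀ x : ℝ, ContinuousAt U x)
    (h1 : ∀ x : ℝ, ‖U x‖ = 1) (h : OnePoint.infty ∈ boundarySpectrum U) :
    boundarySpectrum U = {OnePoint.infty} := by
  ext ξ
  induction ξ using OnePoint.rec with
  | infty => simpa using h
  | coe x => simpa using coe_notMem_boundarySpectrum (hc x) (h1 x)

lemma isInner_of_continuousAt {U : ℂ → ℂ} (hd : DifferentiableOn ℂ U upperHalfPlaneSet)
    (hle : ∀ z ∈ upperHalfPlaneSet, ‖U z‖ ≤ 1) (hc : ∀ x : ℝ, ContinuousAt U x)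
    (h1 : ∀ x : ℝ, ‖U x‖ = 1) : IsInner U :=
  ⟨hd, hle, Eventually.of_forall fun x => ⟨U x, h1 x, ContinuousAt.tendsto_boundary (hc x)⟩⟩

/-! ### The exponential inner function -/

/-- The singular inner function `z ↦ exp (2 i z)`. -/
def expInner (z : ℂ) : ℂ := exp (2 * I * z)

lemma differentiable_expInner : Differentiable ℂ expInner := by
  unfold expInner
  fun_prop

lemma norm_expInner (z : ℂ) : ‖expInner z‖ = Real.exp (-2 * z.im) := by
  simp [expInner, norm_exp]

lemma norm_expInner_le_one {z : ℂ} (hz : 0 ≤ z.im) : ‖expInner z‖ ≤ 1 := by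
  rw [norm_expInner, Real.exp_le_one_iff]
  linarith

lemma norm_expInner_ofReal (x : ℝ) : ‖expInner x‖ = 1 := by
  simp [norm_expInner]

lemma expInner_ne_zero (z : ℂ) : expInner z ≠ 0 := exp_ne_zero _

lemma isInner_expInner : IsInner expInner :=
  isInner_of_continuousAt differentiable_expInner.differentiableOn
    (fun _ hz => norm_expInner_le_one (le_of_lt hz))
    (fun _ => differentiable_expInner.continuous.continuousAt) norm_expInner_ofReal

lemma boundarySpectrum_expInner : boundarySpectrum expInner = {OnePoint.infty} := by
  refine boundarySpectrum_eq_singleton_infty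
    (fun _ => differentiable_expInner.continuous.continuousAt) norm_expInner_ofReal
    (infty_mem_boundarySpectrum (z := fun n : ℕ => (n : ℂ) * I) ?_ ?_ ?_)
  · rw [← Metric.cobounded_eq_cocompact, ← comap_norm_atTop, tendsto_comap_iff]
    simpa [Function.comp_def] using tendsto_natCast_atTop_atTop (R := ℝ)
  · filter_upwards [eventually_gt_atTop 0] with n hn
    simpa [upperHalfPlaneSet] using hn
  · rw [tendsto_zero_iff_norm_tendsto_zero]
    simp only [norm_expInner]
    refine Real.tendsto_exp_atBot.comp ?_
    simpa using (tendsto_natCast_atTop_atTop (R := ℝ)).const_mul_atTop_of_neg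
      (by norm_num : (-2 : ℝ) < 0)

/-! ### Angular derivative of the exponential at infinity -/

lemma im_cayleyInv (z : ℂ) : (cayleyInv z).im = (1 - ‖z‖ ^ 2) / ‖1 - z‖ ^ 2 := by
  rw [cayleyInv, Complex.div_im, ← normSq_eq_norm_sq, ← normSq_eq_norm_sq, ← sub_div]
  congr 1
  simp [normSq_apply]
  ring

lemma not_hasFiniteAngularDerivAtInfty_expInner : ¬ HasFiniteAngularDerivAtInfty expInner := by
  rw [HasFiniteAngularDerivAtInfty, HasFiniteAngularDeriv, not_lt, top_le_iff]
  -- A lower bound in `|1 - z|` alone, so that the quotient blows up however `z` approaches `1`. It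
  -- rests on `exp t ≥ 1 + t` and `1 - |z| ≤ |1 - z|`.
  have hlow : ∀ z ∈ Metric.ball (0 : ℂ) 1,
      2 / (‖1 - z‖ ^ 2 + 2 * ‖1 - z‖) ≤ (1 - ‖expInner (cayleyInv z)‖) / (1 - ‖z‖) := by
    intro z hz
    rw [mem_ball_zero_iff] at hz
    have hd : 0 < 1 - ‖z‖ := by linarith
    have hle : 1 - ‖z‖ ≤ ‖1 - z‖ := by simpa using norm_sub_norm_le (1 : ℂ) z
    set d := ‖1 - z‖
    set r := ‖z‖
    have hdpos : 0 < d := by linarith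
    have hr : 0 ≤ r := norm_nonneg z
    set t : ℝ := 2 * ((1 - r ^ 2) / d ^ 2)
    have ht : 2 * (1 - r) / d ^ 2 ≤ t := by
      rw [mul_div_assoc]
      change 2 * ((1 - r) / d ^ 2) ≤ 2 * ((1 - r ^ 2) / d ^ 2)
      gcongr
      nlinarith
    have htpos : 0 < 2 * (1 - r) / d ^ 2 := by positivity
    have hexp : Real.exp (-t) ≤ 1 / (1 + t) := by
      rw [Real.exp_neg, ← one_div]
      exact one_div_le_one_div_of_le (by linarith) (by linarith [Real.add_one_le_exp t])
    have hmono : 1 / (1 + t) ≤ 1 / (1 + 2 * (1 - r) / d ^ 2) :=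
      one_div_le_one_div_of_le (by linarith) (by linarith)
    have hval : 1 - 1 / (1 + 2 * (1 - r) / d ^ 2) = 2 * (1 - r) / (d ^ 2 + 2 * (1 - r)) := by
      have : d ^ 2 + 2 * (1 - r) ≠ 0 := by positivity
      field_simp
      ring
    have hnorm : ‖expInner (cayleyInv z)‖ = Real.exp (-t) := by
      rw [norm_expInner, im_cayleyInv]
      congr 1
      ring
    rw [hnorm, le_div_iff₀ hd]
    calc 2 / (d ^ 2 + 2 * d) * (1 - r) ≤ 2 / (d ^ 2 + 2 * (1 - r)) * (1 - r) := by gcongr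
      _ = 2 * (1 - r) / (d ^ 2 + 2 * (1 - r)) := by ring
      _ ≤ 1 - Real.exp (-t) := by linarith
  have hlim : Tendsto (fun z : ℂ => 2 / (‖1 - z‖ ^ 2 + 2 * ‖1 - z‖))
      (𝓝[Metric.ball (0 : ℂ) 1] 1) atTop := by
    have hc : Continuous fun z : ℂ => ‖1 - z‖ ^ 2 + 2 * ‖1 - z‖ := by fun_prop
    have h0 : Tendsto (fun z : ℂ => ‖1 - z‖ ^ 2 + 2 * ‖1 - z‖)
        (𝓝[Metric.ball (0 : ℂ) 1] 1) (𝓝[>] 0) := by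
      refine tendsto_nhdsWithin_iff.2
        ⟨by simpa using (hc.tendsto 1).mono_left nhdsWithin_le_nhds, ?_⟩
      filter_upwards [self_mem_nhdsWithin] with z hz
      have hz1 : 1 - z ≠ 0 := by
        rintro h
        rw [← sub_eq_zero.1 h] at hz
        simp at hz
      have := norm_pos_iff.2 hz1
      exact Set.mem_Ioi.2 (by positivity)
    simpa [div_eq_mul_inv] using h0.inv_tendsto_nhdsGT_zero.const_mul_atTop two_pos
  have ht : Tendsto (fun z : ℂ => (1 - ‖expInner (cayleyInv z)‖) / (1 - ‖z‖))
      (𝓝[Metric.ball (0 : ℂ) 1] 1) atTop :=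
    tendsto_atTop_mono' _ (eventually_nhdsWithin_of_forall hlow) hlim
  rw [EReal.eq_top_iff_forall_lt]
  intro M
  refine lt_of_lt_of_le (EReal.coe_lt_coe_iff.2 (lt_add_one M)) (le_liminf_of_le
    (by isBoundedDefault) ?_)
  filter_upwards [ht.eventually_ge_atTop (M + 1)] with z hz
  exact EReal.coe_le_coe_iff.2 hz

/-! ### The second inner function

With `U = exp (2 i z)` and the Herglotz function `w = z + tan z = z + i (1 - U) / (1 + U)`, it is
`(z - i) / (z + i) * ((w - i) / (w + i))`. -/

/-- The numerator `(1 + U) (w - i)` of `(w - i) / (w + i)`. -/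
def herglotzNum (z : ℂ) : ℂ := z * (1 + expInner z) - 2 * I * expInner z

/-- The denominator `(1 + U) (w + i)` of `(w - i) / (w + i)`. -/
def herglotzDen (z : ℂ) : ℂ := z * (1 + expInner z) + 2 * I

/-- The inner function `(z - i) / (z + i) * ((w - i) / (w + i))`. -/
def tanInner (z : ℂ) : ℂ := (z - I) / (z + I) * (herglotzNum z / herglotzDen z)

/-- A multiplier from the model space of `expInner` into that of `tanInner`. -/
def tanMultiplier (z : ℂ) : ℂ := ((z + I) * herglotzDen z)⁻¹

/-! ### Estimates on the closed upper half plane -/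

/-- This is `|w + i|² - |w - i|² = 4 Im w` multiplied by `|1 + U|²`, a form that survives at the
poles of `tan`. -/
lemma normSq_herglotzDen_sub (z : ℂ) :
    ‖herglotzDen z‖ ^ 2 - ‖herglotzNum z‖ ^ 2 =
      4 * (z.im * ‖1 + expInner z‖ ^ 2 + (1 - ‖expInner z‖ ^ 2)) := by
  simp only [← normSq_eq_norm_sq, herglotzDen, herglotzNum, normSq_apply]
  simp
  ring

lemma norm_herglotzNum_le {z : ℂ} (hz : 0 ≤ z.im) : ‖herglotzNum z‖ ≤ ‖herglotzDen z‖ := by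
  have h := normSq_herglotzDen_sub z
  have h1 := norm_expInner_le_one hz
  have h2 : 0 ≤ z.im * ‖1 + expInner z‖ ^ 2 := by positivity
  refine le_of_sq_le_sq ?_ (norm_nonneg _)
  nlinarith [norm_nonneg (expInner z)]

lemma norm_herglotzNum_ofReal (x : ℝ) : ‖herglotzNum x‖ = ‖herglotzDen x‖ := by
  have h := normSq_herglotzDen_sub x
  simp only [ofReal_im, norm_expInner_ofReal] at h
  exact ((sq_eq_sq₀ (norm_nonneg _) (norm_nonneg _)).1 (by linarith)).symm

/-- Amounts to `|w + i| ≥ Im (w + i) ≥ 1`, multiplied by `|1 + U|`. -/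
lemma norm_one_add_expInner_le {z : ℂ} (hz : 0 ≤ z.im) :
    ‖1 + expInner z‖ ≤ ‖herglotzDen z‖ := by
  have h1 := norm_expInner_le_one hz
  have hid : (herglotzDen z * starRingEnd ℂ (1 + expInner z)).im =
      (z.im + 1) * ‖1 + expInner z‖ ^ 2 + (1 - ‖expInner z‖ ^ 2) := by
    simp only [← normSq_eq_norm_sq, herglotzDen, normSq_apply]
    simp
    ring
  have hle : (herglotzDen z * starRingEnd ℂ (1 + expInner z)).im ≤
      ‖herglotzDen z‖ * ‖1 + expInner z‖ := by
    refine (im_le_norm _).trans ?_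
    rw [norm_mul, RCLike.norm_conj]
  rcases (norm_nonneg (1 + expInner z)).eq_or_lt with h0 | h0
  · rw [← h0]
    exact norm_nonneg _
  · have h2 : 0 ≤ z.im * ‖1 + expInner z‖ ^ 2 := by positivity
    have h3 : ‖expInner z‖ ^ 2 ≤ 1 := pow_le_one₀ (norm_nonneg _) h1
    refine le_of_mul_le_mul_right ?_ h0
    nlinarith

lemma one_le_norm_add_I {z : ℂ} (hz : 0 ≤ z.im) : 1 ≤ ‖z + I‖ := by
  refine le_trans ?_ (im_le_norm (z + I))
  simpa using hz

lemma norm_sub_I_le {z : ℂ} (hz : 0 ≤ z.im) : ‖z - I‖ ≤ ‖z + I‖ := by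
  refine le_of_sq_le_sq ?_ (norm_nonneg _)
  simp only [← normSq_eq_norm_sq, normSq_apply]
  simp
  nlinarith

lemma norm_le_norm_add_I {z : ℂ} (hz : 0 ≤ z.im) : ‖z‖ ≤ ‖z + I‖ := by
  refine le_of_sq_le_sq ?_ (norm_nonneg _)
  simp only [← normSq_eq_norm_sq, normSq_apply]
  simp
  nlinarith

/-- Bounds the multiplier by `1` and excludes zeros of the denominators up to the real line. The
factor `z + i` is needed: `D` is of size `1/x` at real points about `1/x` beyond a large pole `x` of
`tan`. If `|z + i| |1 + U|` is small, the constant term `2 i` dominates `D`. -/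
lemma one_le_norm_mul_herglotzDen {z : ℂ} (hz : 0 ≤ z.im) : 1 ≤ ‖(z + I) * herglotzDen z‖ := by
  have hI := one_le_norm_add_I hz
  rw [norm_mul]
  rcases le_total 1 (‖z + I‖ * ‖1 + expInner z‖) with h | h
  · exact h.trans (by gcongr; exact norm_one_add_expInner_le hz)
  · have h1 : ‖z * (1 + expInner z)‖ ≤ 1 := by
      rw [norm_mul]
      exact le_trans (by gcongr; exact norm_le_norm_add_I hz) h
    have h2 : (2 : ℝ) ≤ ‖herglotzDen z‖ + ‖z * (1 + expInner z)‖ := by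
      have : (2 * I : ℂ) = herglotzDen z - z * (1 + expInner z) := by
        rw [herglotzDen]
        ring
      calc (2 : ℝ) = ‖(2 * I : ℂ)‖ := by simp
        _ ≤ _ := by
          rw [this]
          exact norm_sub_le _ _
    nlinarith

lemma mul_herglotzDen_ne_zero {z : ℂ} (hz : 0 ≤ z.im) : (z + I) * herglotzDen z ≠ 0 :=
  norm_pos_iff.1 (one_pos.trans_le (one_le_norm_mul_herglotzDen hz))

lemma add_I_ne_zero {z : ℂ} (hz : 0 ≤ z.im) : z + I ≠ 0 :=
  left_ne_zero_of_mul (mul_herglotzDen_ne_zero hz)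

lemma herglotzDen_ne_zero {z : ℂ} (hz : 0 ≤ z.im) : herglotzDen z ≠ 0 :=
  right_ne_zero_of_mul (mul_herglotzDen_ne_zero hz)

lemma differentiable_herglotzNum : Differentiable ℂ herglotzNum := by
  unfold herglotzNum
  have := differentiable_expInner
  fun_prop

lemma differentiable_herglotzDen : Differentiable ℂ herglotzDen := by
  unfold herglotzDen
  have := differentiable_expInner
  fun_prop

lemma differentiableAt_tanInner {z : ℂ} (hz : 0 ≤ z.im) : DifferentiableAt ℂ tanInner z := by
  have h1 : DifferentiableAt ℂ (fun z : ℂ => (z - I) / (z + I)) z :=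
    DifferentiableAt.fun_div (by fun_prop) (by fun_prop) (add_I_ne_zero hz)
  exact h1.fun_mul ((differentiable_herglotzNum z).fun_div (differentiable_herglotzDen z)
    (herglotzDen_ne_zero hz))

lemma differentiableAt_tanMultiplier {z : ℂ} (hz : 0 ≤ z.im) :
    DifferentiableAt ℂ tanMultiplier z := by
  have h1 : DifferentiableAt ℂ (fun z : ℂ => (z + I) * herglotzDen z) z :=
    DifferentiableAt.fun_mul (by fun_prop) (differentiable_herglotzDen z)
  exact h1.fun_inv (mul_herglotzDen_ne_zero hz)

lemma norm_tanInner_le {z : ℂ} (hz : 0 ≤ z.im) :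
    ‖tanInner z‖ ≤ ‖herglotzNum z / herglotzDen z‖ := by
  rw [tanInner, norm_mul, norm_div]
  exact mul_le_of_le_one_left (norm_nonneg _)
    (div_le_one_of_le₀ (norm_sub_I_le hz) (norm_nonneg _))

lemma norm_tanInner_le_one {z : ℂ} (hz : 0 ≤ z.im) : ‖tanInner z‖ ≤ 1 := by
  refine (norm_tanInner_le hz).trans ?_
  rw [norm_div]
  exact div_le_one_of_le₀ (norm_herglotzNum_le hz) (norm_nonneg _)

lemma norm_tanInner_ofReal (x : ℝ) : ‖tanInner x‖ = 1 := by
  have hx : 0 ≤ (x : ℂ).im := by simp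
  have h1 : ‖(x : ℂ) - I‖ = ‖(x : ℂ) + I‖ := by
    rw [← RCLike.norm_conj]
    simp
  rw [tanInner, norm_mul, norm_div, norm_div, h1, norm_herglotzNum_ofReal,
    div_self (norm_ne_zero_iff.2 (add_I_ne_zero hx)),
    div_self (norm_ne_zero_iff.2 (herglotzDen_ne_zero hx)), one_mul]

lemma continuousAt_tanInner_ofReal (x : ℝ) : ContinuousAt tanInner x :=
  (differentiableAt_tanInner (by simp)).continuousAt

lemma isInner_tanInner : IsInner tanInner :=
  isInner_of_continuousAt
    (fun _ hz => (differentiableAt_tanInner (le_of_lt hz)).differentiableWithinAt)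
    (fun _ hz => norm_tanInner_le_one (le_of_lt hz)) continuousAt_tanInner_ofReal
    norm_tanInner_ofReal

/-! ### The multiplier, and the spectrum of the second function -/

lemma tanInner_mul_conj_tanMultiplier (x : ℝ) :
    tanInner x * starRingEnd ℂ (tanMultiplier x) = expInner x * tanMultiplier x := by
  have hx : 0 ≤ (x : ℂ).im := by simp
  have hU : expInner x * starRingEnd ℂ (expInner x) = 1 := by
    rw [mul_conj, normSq_eq_norm_sq, norm_expInner_ofReal]
    simp
  -- On the real line `w` is real where defined and `U * conj (1 + U) = 1 + U`.
  have hnum : herglotzNum x = expInner x * starRingEnd ℂ (herglotzDen x) := by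
    simp only [herglotzNum, herglotzDen, map_add, map_mul, conj_ofReal, map_one, conj_I,
      map_ofNat]
    linear_combination -(x : ℂ) * hU
  have hI := add_I_ne_zero hx
  have hD := herglotzDen_ne_zero hx
  have hI' : (x : ℂ) - I ≠ 0 := by
    have := (map_ne_zero (starRingEnd ℂ)).2 hI
    simpa [sub_eq_add_neg] using this
  have hD' : starRingEnd ℂ (herglotzDen x) ≠ 0 := (map_ne_zero (starRingEnd ℂ)).2 hD
  have hc : starRingEnd ℂ (tanMultiplier x) = (((x : ℂ) - I) * starRingEnd ℂ (herglotzDen x))⁻¹ := by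
    simp [tanMultiplier, sub_eq_add_neg]
  rw [hc, tanInner, hnum, tanMultiplier]
  field_simp

lemma tanMultiplier_ne_zero {z : ℂ} (hz : 0 ≤ z.im) : tanMultiplier z ≠ 0 :=
  inv_ne_zero (mul_herglotzDen_ne_zero hz)

lemma tanMultiplier_mem_multipliers : tanMultiplier ∈ multipliers expInner tanInner := by
  refine mem_multipliers_of_conj_mul_eq
    (fun _ hz => (differentiableAt_tanMultiplier (le_of_lt hz)).differentiableWithinAt)
    (fun z hz => ?_)
    (fun x => (differentiableAt_tanMultiplier (by simp)).continuousAt)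
    (fun x => tanMultiplier_ne_zero (by simp))
    (fun _ => differentiable_expInner.continuous.continuousAt)
    (fun _ => expInner_ne_zero _) continuousAt_tanInner_ofReal
    (fun x => norm_ne_zero_iff.1 (by simp [norm_tanInner_ofReal]))
    tanInner_mul_conj_tanMultiplier
  rw [tanMultiplier, norm_inv]
  exact inv_le_one_of_one_le₀ (one_le_norm_mul_herglotzDen (le_of_lt hz))

/-- If `exp (2 i p) = -1` and `exp (2 i ζ) = p / (p - 2 i)`, then `w - i` and `w + i` are in the
ratio `ζ : ζ + 2 i` at `p + ζ`. -/
lemma herglotzNum_div_herglotzDen_add {p ζ : ℂ} (hp : expInner p = -1) (hp2 : p - 2 * I ≠ 0)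
    (hζ : expInner ζ = p / (p - 2 * I)) :
    herglotzNum (p + ζ) / herglotzDen (p + ζ) = ζ / (ζ + 2 * I) := by
  have hU : expInner (p + ζ) = -(p / (p - 2 * I)) := by
    rw [← hζ, expInner, mul_add, exp_add, ← expInner, ← expInner, hp]
    ring
  have h1 : herglotzNum (p + ζ) = (-2 * I / (p - 2 * I)) * ζ := by
    rw [herglotzNum, hU]
    field_simp
    ring
  have h2 : herglotzDen (p + ζ) = (-2 * I / (p - 2 * I)) * (ζ + 2 * I) := by
    rw [herglotzDen, hU]
    field_simp
    ring
  have h3 : -2 * I / (p - 2 * I) ≠ 0 := div_ne_zero (by simp) hp2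
  rw [h1, h2, mul_div_mul_left _ _ h3]

lemma boundarySpectrum_tanInner : boundarySpectrum tanInner = {OnePoint.infty} := by
  -- The positive poles of `tan`, near which `w` takes values close to `i`.
  set p : ℕ → ℝ := fun n => Real.pi / 2 + n * Real.pi with hp
  have hp0 : ∀ n, 0 < p n := fun n => by positivity
  have hpU : ∀ n, expInner (p n) = -1 := by
    intro n
    have : 2 * I * (p n : ℂ) = Real.pi * I + n * (2 * Real.pi * I) := by
      simp only [hp]
      push_cast
      ring
    rw [expInner, this, exp_add, exp_pi_mul_I, exp_nat_mul_two_pi_mul_I, mul_one]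
  have hpt : Tendsto p atTop atTop :=
    tendsto_atTop_add_const_left _ _
      ((tendsto_natCast_atTop_atTop (R := ℝ)).atTop_mul_const Real.pi_pos)
  have hp2 : ∀ n, (p n : ℂ) - 2 * I ≠ 0 := by
    intro n h
    have := congrArg Complex.im h
    simp at this
  -- With `U = -e n`, the expression `z (1 + U) - 2 i U` vanishes at `z = p n`. At `z = p n + ζ n`
  -- only a multiple of `ζ n` remains.
  set e : ℕ → ℂ := fun n => (p n : ℂ) / (p n - 2 * I) with he
  have he0 : ∀ n, e n ≠ 0 := fun n => div_ne_zero (by exact_mod_cast (hp0 n).ne') (hp2 n)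
  have het : Tendsto e atTop (𝓝 1) := by
    have h1 : Tendsto (fun n => ((p n)⁻¹ : ℝ)) atTop (𝓝 0) := tendsto_inv_atTop_zero.comp hpt
    have h2 : Tendsto (fun n => (1 - 2 * I * ((p n)⁻¹ : ℝ) : ℂ)⁻¹) atTop (𝓝 1) := by
      have h3 : Continuous fun t : ℝ => (1 - 2 * I * t : ℂ) := by fun_prop
      have h4 := ((h3.tendsto 0).comp h1).inv₀ (by simp)
      simpa [Function.comp_def] using h4
    refine h2.congr fun n => ?_
    have := hp2 n
    have hpn : (p n : ℂ) ≠ 0 := by exact_mod_cast (hp0 n).ne'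
    simp only [he]
    rw [← inv_inj, inv_inv, inv_div]
    push_cast
    field_simp
  -- The principal logarithm gives the small solution of `exp (2 i ζ) = e n`, because `e n → 1`; `|e
  -- n| < 1` then puts it in the upper half plane.
  set ζ : ℕ → ℂ := fun n => -I / 2 * log (e n) with hζ
  have hζU : ∀ n, expInner (ζ n) = e n := by
    intro n
    have : 2 * I * ζ n = log (e n) := by
      simp only [hζ]
      linear_combination -log (e n) * I_sq
    rw [expInner, this, exp_log (he0 n)]
  have hζt : Tendsto ζ atTop (𝓝 0) := by
    have := (het.clog one_mem_slitPlane).const_mul (-I / 2)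
    simpa using this
  have hζim : ∀ n, 0 < (ζ n).im := by
    intro n
    have h1 : ‖e n‖ < 1 := by
      simp only [he]
      rw [norm_div, div_lt_one (norm_pos_iff.2 (hp2 n))]
      refine lt_of_pow_lt_pow_left₀ 2 (norm_nonneg _) ?_
      simp only [← normSq_eq_norm_sq, normSq_apply]
      simp
    rw [← hζU, norm_expInner, Real.exp_lt_one_iff] at h1
    linarith
  have hzim : ∀ n, 0 < ((p n : ℂ) + ζ n).im := fun n => by simpa using hζim n
  refine boundarySpectrum_eq_singleton_infty continuousAt_tanInner_ofReal norm_tanInner_ofReal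
    (infty_mem_boundarySpectrum (z := fun n => (p n : ℂ) + ζ n) ?_ (Eventually.of_forall hzim) ?_)
  · rw [← Metric.cobounded_eq_cocompact, ← comap_norm_atTop, tendsto_comap_iff]
    refine tendsto_atTop_mono (fun n => ?_) (hpt.atTop_add hζt.norm.neg)
    have := norm_sub_le_norm_add (p n : ℂ) (ζ n)
    rw [norm_real, Real.norm_of_nonneg (hp0 n).le] at this
    simpa [sub_eq_add_neg] using this
  · have h1 : Tendsto (fun n => ζ n / (ζ n + 2 * I)) atTop (𝓝 0) := by
      have := hζt.div (hζt.add_const (2 * I)) (by simp)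
      simpa [Pi.div_def] using this
    refine squeeze_zero_norm (fun n => ?_) (tendsto_zero_iff_norm_tendsto_zero.1 h1)
    rw [← herglotzNum_div_herglotzDen_add (hpU n) (hp2 n) (hζU n)]
    exact norm_tanInner_le (hzim n).le

/-! ### Angular derivative of the second function at infinity -/

/-- On the imaginary axis both factors are real; their defects from `1` are at most `2 / (1 + y)`
and `4 / (1 + y)`. -/
lemma one_sub_norm_tanInner_le {y : ℝ} (hy : 0 < y) :
    1 - ‖tanInner (y * I)‖ ≤ 6 / (1 + y) := by
  set u : ℝ := Real.exp (-2 * y)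
  have hu : 0 < u := Real.exp_pos _
  have hU : expInner (y * I) = u := by
    rw [expInner, ofReal_exp]
    congr 1
    push_cast
    linear_combination 2 * (y : ℂ) * I_sq
  have hval : tanInner (y * I) =
      (((y - 1) / (y + 1) * ((y * (1 + u) - 2 * u) / (y * (1 + u) + 2)) : ℝ) : ℂ) := by
    have h1 : ((y * I - I) / (y * I + I) : ℂ) = (y - 1) / (y + 1) := by
      rw [← sub_one_mul, ← add_one_mul, mul_div_mul_right _ _ I_ne_zero]
    have h2 : herglotzNum (y * I) / herglotzDen (y * I) =
        (y * (1 + u) - 2 * u) / (y * (1 + u) + 2) := by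
      rw [herglotzNum, herglotzDen, hU, ← mul_div_mul_right ((y : ℂ) * (1 + u) - 2 * u) _ I_ne_zero]
      congr 1 <;> ring
    rw [tanInner, h1, h2]
    push_cast
    rfl
  have hpos : 0 < y * (1 + u) + 2 := by positivity
  have h1 : 1 - (y - 1) / (y + 1) = 2 / (1 + y) := by
    field_simp
    ring
  have h2 : 1 - (y * (1 + u) - 2 * u) / (y * (1 + u) + 2) =
      (2 + 2 * u) / (y * (1 + u) + 2) := by
    field_simp
    ring
  have h3 : (2 + 2 * u) / (y * (1 + u) + 2) ≤ 4 / (1 + y) := by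
    rw [div_le_div_iff₀ hpos (by positivity)]
    nlinarith [mul_pos hu hy, Real.exp_le_one_iff.2 (by linarith : -2 * y ≤ 0)]
  have h4 : 0 ≤ (2 + 2 * u) / (y * (1 + u) + 2) := by positivity
  have h5 : 0 ≤ 2 / (1 + y) := by positivity
  have h6 : 6 / (1 + y) = 2 / (1 + y) + 4 / (1 + y) := by ring
  rw [hval, norm_real]
  refine le_trans (sub_le_sub_left (Real.le_norm_self _) 1) ?_
  rw [h6]
  -- `1 - a b = (1 - a) + (1 - b) - (1 - a) (1 - b)`, where both defects are nonnegative.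
  nlinarith

lemma hasFiniteAngularDerivAtInfty_tanInner : HasFiniteAngularDerivAtInfty tanInner := by
  rw [HasFiniteAngularDerivAtInfty, HasFiniteAngularDeriv]
  refine lt_of_le_of_lt ?_ (EReal.coe_lt_top 3)
  -- For a liminf the radial approach suffices; `r` corresponds to `y = (1 + r) / (1 - r)`, where `6
  -- / (1 + y) = 3 (1 - r)`.
  refine liminf_le_of_frequently_le' ?_
  have ht : Tendsto (fun r : ℝ => (r : ℂ)) (𝓝[<] 1) (𝓝[Metric.ball (0 : ℂ) 1] 1) := by
    refine tendsto_nhdsWithin_iff.2 ⟨?_, ?_⟩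
    · exact (continuous_ofReal.tendsto 1).mono_left nhdsWithin_le_nhds
    · filter_upwards [Ioo_mem_nhdsLT (zero_lt_one' ℝ)] with r hr
      simpa [abs_of_pos hr.1] using hr.2
  refine ht.frequently (Eventually.frequently ?_)
  filter_upwards [Ioo_mem_nhdsLT (zero_lt_one' ℝ)] with r hr
  obtain ⟨hr0, hr1⟩ := hr
  have h1 : 0 < 1 - r := by linarith
  have hc : cayleyInv r = (((1 + r) / (1 - r) : ℝ) : ℂ) * I := by
    rw [cayleyInv]
    push_cast
    ring
  have h := one_sub_norm_tanInner_le (y := (1 + r) / (1 - r)) (by positivity)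
  have h6 : 6 / (1 + (1 + r) / (1 - r)) = 3 * (1 - r) := by
    field_simp
    ring
  rw [h6, ← hc] at h
  rw [EReal.coe_le_coe_iff, norm_real, Real.norm_of_nonneg hr0.le, div_le_iff₀ h1]
  exact h

end HalfPlaneModel

end

theorem proposition6p11 :
    ∃ U V : ℂ → ℂ,
      HalfPlaneModel.IsInner U ∧ HalfPlaneModel.IsInner V ∧
      (∃ Φ ∈ HalfPlaneModel.multipliers U V, ∃ z ∈ UpperHalfPlane.upperHalfPlaneSet, Φ z ≠ 0) ∧
      HalfPlaneModel.boundarySpectrum U = {OnePoint.infty} ∧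
      HalfPlaneModel.boundarySpectrum V = {OnePoint.infty} ∧
      HalfPlaneModel.HasFiniteAngularDerivAtInfty V ∧
      ¬ HalfPlaneModel.HasFiniteAngularDerivAtInfty U := by
  open HalfPlaneModel in
  exact ⟨expInner, tanInner, isInner_expInner, isInner_tanInner,
    ⟨tanMultiplier, tanMultiplier_mem_multipliers, Complex.I,
      by simp [UpperHalfPlane.upperHalfPlaneSet],
      tanMultiplier_ne_zero (by simp)⟩,
    boundarySpectrum_expInner, boundarySpectrum_tanInner, hasFiniteAngularDerivAtInfty_tanInner,
    not_hasFiniteAngularDerivAtInfty_expInner⟩
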